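/- Let $N\ge 1$ and let $(M,\mathbf g)$ be a connected compact $N$-dimensional $C^\infty$ Riemannian manifold with (possibly empty) smooth boundary $\partial M$ and outward unit normal $\nu$. For $\epsilon>0$ let $\chi_\epsilon(M)$ be the class of measurable sets $A\subset M$ with $\mathrm{meas}_M(A)+\mathrm{meas}_{\partial M}(A\cap\partial M)<\epsilon$ (Riemannian measures). An open set $\omega\subset M$ is an admissible $\varepsilon$-controllable region, with data $(\varepsilon_0,V,d)$, if $0<\varepsilon_0<\varepsilon$ and * $V\subset M$ is open, $\overline{\partial V\cap \mathrm{int}(M)}$ is a smooth hypersurface that meets $\partial M$ transversally, and $\overline{M\setminus V}\in\chi_{\varepsilon_0}(M)$; * $d\in C^\infty(M)$, $\mathrm{Hess}\,d(X,X)\ge |X|_{\mathbf g}^2$ for all $X\in T_xM$, $x\in\overline V$, $\inf_V|\nabla d|_{\mathbf g}>0$, $\min_{\overline V}d>0$, and $\langle\nabla d,\nu\rangle<0$ on $\partial M\cap\overline V$; * $\omega\in\chi_\varepsilon(M)$, $\overline{M\setminus V}\subset\omega$, and $\omega\cap V\in\chi_{\varepsilon-\varepsilon_0}(M)$. Let $\omega$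 be such a region and let $V=V_1\sqcup\dots\sqcup V_m$ with $V_1,\dots,V_m$ nonempty, connected, open and pairwise disjoint. For $k\ge m$ put $V_j=\emptyset$ for $m<j\le k$. Call connected open sets $\Omega_1,\dots,\Omega_k\subset M$ and functions $d_1,\dots,d_k:M\to\mathbb R$ an overlapping decomposition if $M=\bigcup_j\Omega_j$, for each $j$ there is $i\neq j$ with $\Omega_i\cap\Omega_j\ne\emptyset$, and for every $j=1,\dots,k$ 1. $V_j\subset\Omega_j$; 2. $\Omega_j\cap\omega\neq\emptyset$; 3. $d_j\in C^\infty(M)$; 4. $\mathrm{Hess}\,d_j(X,X)\ge|X|_{\mathbf g}^2$ for all $X\in T_qM$, $q\in\Omega_j$; 5. $\inf_{\Omega_j}|\nabla d_j|_{\mathbf g}>0$ and $\inf_{\Omega_j}d_j>0$; 6. $\langle\nabla d_j,\nu\rangle<0$ on $\partial M\cap\overline{V_j}$. Then there is an overlapping decomposition for some finite $k\ge m$. Moreover, one can take $k=m$ whenever $m\ge2$ and $M$ is covered by connected open sets $W_1,\dots,W_m$ with $\overline{V_j}\subset W_j$ that carry local functions $f_j\in C^\infty(W_j)$ with $\mathrm{Hess}\,f_j(X,X)\ge|X|^2_{\mathbf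 g}$ for all $X\in T_qM$, $q\in W_j$, $\inf_{W_j}|\nabla f_j|_{\mathbf g}>0$, $\inf_{W_j}f_j>0$, and $\langle\nabla f_j,\nu\rangle<0$ on $\partial M\cap\overline{V_j}$. -/

import Mathlib

open Set MeasureTheory Bundle
open scoped Manifold ContDiff Topology ENNReal

noncomputable section

namespace Escape

/-- The model space `ℝ^N`.  Manifolds with boundary are modelled on the half space
`{y ∈ ℝ^N | 0 ≤ y 0}`, and `TangentSpace (𝓡∂ N) x` is `ℝ^N` through the preferred chart at `x`. -/
abbrev Model (N : ℕ) : Type := EuclideanSpace ℝ (Fin N)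

section

variable {N : ℕ} [NeZero N] {M : Type*} [TopologicalSpace M]
  [ChartedSpace (EuclideanHalfSpace N) M] [IsManifold (𝓡∂ N) ∞ M]

variable (N M) in
/-- Smooth Riemannian metrics on `M`. -/
abbrev SmoothMetric : Type _ :=
  ContMDiffRiemannianMetric (𝓡∂ N) ∞ (Model N) (fun x : M => TangentSpace (𝓡∂ N) x)

/-- The scalar product of the metric on the tangent space at `x`, read in the preferred chart
at `x`. -/
def metricAt (g : SmoothMetric N M) (x : M) : Model N →L[ℝ] Model N →L[ℝ] ℝ := g.inner x

theorem metricAt_pos (g : SmoothMetric N M) (x : M) (v : Model N) (hv : v ≠ 0) :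
    0 < metricAt g x v v := g.pos x v hv

/-- The differential of `f` at `x`, read in the preferred chart at `x`. -/
def differential (f : M → ℝ) (x : M) : Model N →L[ℝ] ℝ := mfderiv (𝓡∂ N) 𝓘(ℝ, ℝ) f x

theorem exists_sharp (g : SmoothMetric N M) (x : M) (l : Model N →L[ℝ] ℝ) :
    ∃ v : Model N, ∀ w, metricAt g x v w = l w := by
  have hinj : Function.Injective
      ((ContinuousLinearMap.coeLM ℝ).comp (metricAt g x).toLinearMap :
        Model N →ₗ[ℝ] (Model N →ₗ[ℝ] ℝ)) := by
    rw [← LinearMap.ker_eq_bot, LinearMap.ker_eq_bot']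
    intro v hv
    by_contra hne
    have h0 : metricAt g x v v = 0 := LinearMap.congr_fun hv v
    exact (metricAt_pos g x v hne).ne' h0
  have hsurj := (LinearMap.injective_iff_surjective_of_finrank_eq_finrank
    (Subspace.dual_finrank_eq (K := ℝ) (V := Model N)).symm).1 hinj
  obtain ⟨v, hv⟩ := hsurj l.toLinearMap
  exact ⟨v, fun w => LinearMap.congr_fun hv w⟩

/-- The tangent vector that represents the covector `l` at `x`. -/
def sharp (g : SmoothMetric N M) (x : M) (l : Model N →L[ℝ] ℝ) : Model N :=
  (exists_sharp g x l).choose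

theorem metricAt_sharp (g : SmoothMetric N M) (x : M) (l : Model N →L[ℝ] ℝ) (w : Model N) :
    metricAt g x (sharp g x l) w = l w := (exists_sharp g x l).choose_spec w

/-- The norm of a tangent vector. -/
def tnorm (g : SmoothMetric N M) (x : M) (v : Model N) : ℝ := √(metricAt g x v v)

/-- The Riemannian gradient. -/
def grad (g : SmoothMetric N M) (f : M → ℝ) (x : M) : Model N := sharp g x (differential f x)

/-- The coordinate expression of the metric in the preferred chart at `p`, as a function of the
point `y` of the half space. -/
def chartMetric (g : SmoothMetric N M) (p : M) (y : Model N) :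
    Model N →L[ℝ] Model N →L[ℝ] ℝ :=
  let D : Model N →L[ℝ] Model N :=
    mfderivWithin 𝓘(ℝ, Model N) (𝓡∂ N) (extChartAt (𝓡∂ N) p).symm (range (𝓡∂ N)) y
  (metricAt g ((extChartAt (𝓡∂ N) p).symm y)).bilinearComp D D

set_option synthInstance.maxHeartbeats 200000 in
/-- First derivatives at `p` of the coefficients of the metric in the preferred chart at `p`. -/
def chartMetricDeriv (g : SmoothMetric N M) (p : M) :
    Model N →L[ℝ] Model N →L[ℝ] Model N →L[ℝ] ℝ :=
  fderivWithin ℝ (chartMetric g p) (range (𝓡∂ N)) (extChartAt (𝓡∂ N) p p)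

/-- The Christoffel symbols of the Levi-Civita connection at `p` in the preferred chart at `p`:
`g (Γ(u,v)) w = (∂_u g(v,w) + ∂_v g(u,w) - ∂_w g(u,v)) / 2`. -/
def christoffel (g : SmoothMetric N M) (p : M) (u v : Model N) : Model N :=
  sharp g p ((1 / 2 : ℝ) • (chartMetricDeriv g p u v + chartMetricDeriv g p v u
    - ((chartMetricDeriv g p).flip u).flip v))

/-- The Hessian `(∇df)(u,v) = ∂_u ∂_v f - df (Γ(u,v))` at `p`. -/
def hess (g : SmoothMetric N M) (f : M → ℝ) (p : M) (u v : Model N) : ℝ :=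
  fderivWithin ℝ (fderivWithin ℝ (f ∘ (extChartAt (𝓡∂ N) p).symm) (range (𝓡∂ N)))
      (range (𝓡∂ N)) (extChartAt (𝓡∂ N) p p) u v
    - differential f p (christoffel g p u v)

/-- The differential at `x` of the first coordinate of the preferred chart at `x`.  At a boundary
point its kernel is the tangent space of the boundary, and it is positive on inward vectors. -/
def normalCoord : Model N →L[ℝ] ℝ := EuclideanSpace.proj (0 : Fin N)

/-- The outward unit normal `ν` at a boundary point (junk at interior points). -/
def outwardNormal (g : SmoothMetric N M) (x : M) : Model N :=
  -((tnorm g x (sharp g x normalCoord))⁻¹ • sharp g x normalCoord)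

theorem outwardNormal_orthogonal (g : SmoothMetric N M) (x : M) (w : Model N) (hw : w 0 = 0) :
    metricAt g x (outwardNormal g x) w = 0 := by
  have h : normalCoord w = 0 := hw
  simp [outwardNormal, metricAt_sharp, h]

/-! ### Measures -/

/-- The Riemannian density `√(det B)` of a bilinear form, the determinant being taken in an
orthonormal basis. -/
def density {F : Type*} [NormedAddCommGroup F] [InnerProductSpace ℝ F] [FiniteDimensional ℝ F]
    (B : F →L[ℝ] F →L[ℝ] ℝ) : ℝ :=
  √(Matrix.det (Matrix.of fun i j =>
    B (stdOrthonormalBasis ℝ F i) (stdOrthonormalBasis ℝ F j)))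

/-- Riemannian volume: the measure that on each chart domain is `√(det g) dy`, i.e. the largest
outer measure that is at most `∫_{φ(A)} √(det g) dy` for each `A` inside the domain of a
chart `φ`. -/
def volumeM (g : SmoothMetric N M) : OuterMeasure M :=
  OuterMeasure.boundedBy fun A =>
    ⨅ (p : M) (_ : A ⊆ (extChartAt (𝓡∂ N) p).source),
      ∫⁻ y in extChartAt (𝓡∂ N) p '' A, ENNReal.ofReal (density (chartMetric g p y))

variable (N) in
/-- The hyperplane `{y 0 = 0}` of `ℝ^N`, into which charts map the boundary. -/
abbrev Wall : Submodule ℝ (Model N) := (normalCoord (N := N)).ker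

/-- Lebesgue measure of the hyperplane `{y 0 = 0}`. -/
def wallMeasure : Measure (Wall N) := (stdOrthonormalBasis ℝ (Wall N)).toBasis.addHaar

/-- Riemannian volume of the boundary with the induced metric, for subsets of the boundary. -/
def volumeBoundary (g : SmoothMetric N M) : OuterMeasure M :=
  OuterMeasure.boundedBy fun A =>
    ⨅ (p : M) (_ : A ⊆ (extChartAt (𝓡∂ N) p).source),
      ∫⁻ y in {y : Wall N | (y : Model N) ∈ extChartAt (𝓡∂ N) p '' A},
        ENNReal.ofReal (density ((chartMetric g p (y : Model N)).bilinearComp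
          (Wall N).subtypeL (Wall N).subtypeL)) ∂wallMeasure

/-- `A` is `ε`-controllable: `meas_M(A) + meas_{∂M}(A ∩ ∂M) < ε`. -/
def IsControllable (g : SmoothMetric N M) (ε : ℝ) (A : Set M) : Prop :=
  MeasurableSet[borel M] A ∧
    volumeM g A + volumeBoundary g (A ∩ (𝓡∂ N).boundary M) < ENNReal.ofReal ε

/-! ### Escape functions and admissible regions -/

/-- `inf_s f > 0`. -/
def PosInfOn (f : M → ℝ) (s : Set M) : Prop := ∃ c : ℝ, 0 < c ∧ ∀ x ∈ s, c ≤ f x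

/-- `Hess f (X,X) ≥ |X|²` for all tangent vectors `X` at points of `s`. -/
def HessGeOn (g : SmoothMetric N M) (f : M → ℝ) (s : Set M) : Prop :=
  ∀ x ∈ s, ∀ X : Model N, tnorm g x X ^ 2 ≤ hess g f x X X

/-- `⟨∇f, ν⟩ < 0` on `∂M ∩ s`. -/
def NormalDerivNegOn (g : SmoothMetric N M) (f : M → ℝ) (s : Set M) : Prop :=
  ∀ x ∈ (𝓡∂ N).boundary M ∩ s, metricAt g x (grad g f x) (outwardNormal g x) < 0

variable (N) in
/-- `S` is a smooth hypersurface of `M` that meets `∂M` transversally: near each of its points it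
is the zero set of a smooth function with nonzero differential, and at boundary points the
differential does not vanish on the tangent space of `∂M`. -/
def IsTransversalHypersurface (S : Set M) : Prop :=
  ∀ p ∈ S, ∃ U : Set M, IsOpen U ∧ p ∈ U ∧ ∃ f : M → ℝ, ContMDiffOn (𝓡∂ N) 𝓘(ℝ, ℝ) ∞ f U ∧
    S ∩ U = {x ∈ U | f x = 0} ∧
    (∀ x ∈ S ∩ U, differential (N := N) f x ≠ 0) ∧
    ∀ x ∈ S ∩ U ∩ (𝓡∂ N).boundary M, ∃ v ∈ Wall N, differential (N := N) f x v ≠ 0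

/-- `R` is an admissible `ε`-controllable region, with parameter `ε₀`, open set `V` and escape
function `d`. -/
structure IsAdmissible (g : SmoothMetric N M) (ε ε₀ : ℝ) (V : Set M) (d : M → ℝ) (R : Set M) :
    Prop where
  eps_pos : 0 < ε₀
  eps_lt : ε₀ < ε
  isOpen_V : IsOpen V
  smooth_boundary : IsTransversalHypersurface N (closure (frontier V ∩ (𝓡∂ N).interior M))
  small_compl : IsControllable g ε₀ (closure Vᶜ)
  smooth : ContMDiff (𝓡∂ N) 𝓘(ℝ, ℝ) ∞ d
  hess_ge : HessGeOn g d (closure V)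
  grad_pos : PosInfOn (fun x => tnorm g x (grad g d x)) V
  pos : PosInfOn d (closure V)
  normal_neg : NormalDerivNegOn g d (closure V)
  isOpen_region : IsOpen R
  small_region : IsControllable g ε R
  compl_subset : closure Vᶜ ⊆ R
  small_inter : IsControllable g (ε - ε₀) (R ∩ V)

/-- `V` is the disjoint union of the connected open sets `V_1, …, V_m`. -/
structure IsPieces {m : ℕ} (V : Set M) (Vj : Fin m → Set M) : Prop where
  isOpen : ∀ j, IsOpen (Vj j)
  isConnected : ∀ j, IsConnected (Vj j)
  disjoint : Pairwise fun i j => Disjoint (Vj i) (Vj j)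
  iUnion : ⋃ j, Vj j = V

/-- A finite family of overlapping subdomains (connected open subsets) of `M`. -/
structure IsOverlapping {k : ℕ} (Ω : Fin k → Set M) : Prop where
  isOpen : ∀ j, IsOpen (Ω j)
  isConnected : ∀ j, IsConnected (Ω j)
  cover : ⋃ j, Ω j = univ
  overlap : ∀ j, ∃ i, i ≠ j ∧ (Ω j ∩ Ω i).Nonempty

/-- Overlapping subdomains `Ω_j ⊇ V_j` that meet `R`, with functions `d_j`. -/
structure IsOverlappingDecomposition (g : SmoothMetric N M) (R : Set M) {k : ℕ}
    (Vj Ω : Fin k → Set M) (d : Fin k → M → ℝ) : Prop where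
  overlapping : IsOverlapping Ω
  subset : ∀ j, Vj j ⊆ Ω j
  meets : ∀ j, (Ω j ∩ R).Nonempty
  smooth : ∀ j, ContMDiff (𝓡∂ N) 𝓘(ℝ, ℝ) ∞ (d j)
  hess_ge : ∀ j, HessGeOn g (d j) (Ω j)
  grad_pos : ∀ j, PosInfOn (fun x => tnorm g x (grad g (d j) x)) (Ω j)
  pos : ∀ j, PosInfOn (d j) (Ω j)
  normal_neg : ∀ j, NormalDerivNegOn g (d j) (closure (Vj j))

/-- A cover of `M` by domains `W_j ⊇ closure V_j`, one for each `V_j`, with a local escape function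
`f_j`, smooth on `W_j` only. -/
structure IsLocalEscapeCover (g : SmoothMetric N M) {k : ℕ}
    (Vj W : Fin k → Set M) (f : Fin k → M → ℝ) : Prop where
  isOpen : ∀ j, IsOpen (W j)
  isConnected : ∀ j, IsConnected (W j)
  cover : ⋃ j, W j = univ
  closure_subset : ∀ j, closure (Vj j) ⊆ W j
  smooth : ∀ j, ContMDiffOn (𝓡∂ N) 𝓘(ℝ, ℝ) ∞ (f j) (W j)
  hess_ge : ∀ j, HessGeOn g (f j) (W j)
  grad_pos : ∀ j, PosInfOn (fun x => tnorm g x (grad g (f j) x)) (W j)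
  pos : ∀ j, PosInfOn (f j) (W j)
  normal_neg : ∀ j, NormalDerivNegOn g (f j) (closure (Vj j))

end

end Escape

end

open Set MeasureTheory Bundle
open scoped Manifold ContDiff Topology ENNReal

noncomputable section

namespace Escape

/-! ### Change of variables for the second derivative and for a field of bilinear forms -/

section Calculus

variable {E : Type*} [NormedAddCommGroup E] [NormedSpace ℝ E] {S : Set E} {y : E} {ψ : E → E}
  {A : E → E →L[ℝ] E} {A' : E →L[ℝ] E →L[ℝ] E}

theorem eventually_fderivWithin_comp (hS : UniqueDiffOn ℝ S) (hψS : MapsTo ψ S S)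
    (hy : y ∈ S) (hA : ∀ᶠ z in 𝓝[S] y, HasFDerivWithinAt ψ (A z) S z) {F f : E → ℝ}
    (hF : ∀ᶠ z in 𝓝[S] ψ y, DifferentiableWithinAt ℝ F S z) (hf : f =ᶠ[𝓝[S] y] F ∘ ψ) :
    fderivWithin ℝ f S =ᶠ[𝓝[S] y] fun z => (fderivWithin ℝ F S (ψ z)).comp (A z) := by
  have hcont : Filter.Tendsto ψ (𝓝[S] y) (𝓝[S] ψ y) :=
    (hA.self_of_nhdsWithin hy).continuousWithinAt.tendsto_nhdsWithin hψS
  have hF' := hcont.eventually hF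
  have hf' := eventually_eventually_nhdsWithin.2 hf
  filter_upwards [hA, hF', hf', self_mem_nhdsWithin] with z hAz hFz hfz hz
  have h1 : HasFDerivWithinAt (F ∘ ψ) ((fderivWithin ℝ F S (ψ z)).comp (A z)) S z :=
    hFz.hasFDerivWithinAt.comp z hAz hψS
  have h2 : HasFDerivWithinAt f ((fderivWithin ℝ F S (ψ z)).comp (A z)) S z :=
    h1.congr_of_eventuallyEq hfz (Filter.EventuallyEq.eq_of_nhdsWithin hfz hz)
  exact h2.fderivWithin (hS z hz)

theorem fderivWithin_fderivWithin_comp (hS : UniqueDiffOn ℝ S) (hψS : MapsTo ψ S S)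
    (hy : y ∈ S) (hA : ∀ᶠ z in 𝓝[S] y, HasFDerivWithinAt ψ (A z) S z)
    (hA' : HasFDerivWithinAt A A' S y) {F f : E → ℝ}
    (hF : ∀ᶠ z in 𝓝[S] ψ y, DifferentiableWithinAt ℝ F S z)
    (hF' : DifferentiableWithinAt ℝ (fderivWithin ℝ F S) S (ψ y)) (hf : f =ᶠ[𝓝[S] y] F ∘ ψ)
    (u v : E) :
    fderivWithin ℝ (fderivWithin ℝ f S) S y u v
      = fderivWithin ℝ (fderivWithin ℝ F S) S (ψ y) (A y u) (A y v)
        + fderivWithin ℝ F S (ψ y) (A' u v) := by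
  have h := eventually_fderivWithin_comp hS hψS hy hA hF hf
  have h1 : HasFDerivWithinAt (fun z => fderivWithin ℝ F S (ψ z)) _ S y :=
    hF'.hasFDerivWithinAt.comp y (hA.self_of_nhdsWithin hy) hψS
  have h2 := (h1.clm_comp hA').congr_of_eventuallyEq h (h.eq_of_nhdsWithin hy)
  rw [h2.fderivWithin (hS y hy)]
  simp [add_comm]

set_option synthInstance.maxHeartbeats 200000 in
theorem fderivWithin_bilinearComp (hS : UniqueDiffOn ℝ S) (hψS : MapsTo ψ S S)
    (hy : y ∈ S) (hA : ∀ᶠ z in 𝓝[S] y, HasFDerivWithinAt ψ (A z) S z)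
    (hA' : HasFDerivWithinAt A A' S y) {G B : E → E →L[ℝ] E →L[ℝ] ℝ}
    (hG : DifferentiableWithinAt ℝ G S (ψ y)) (hBd : DifferentiableWithinAt ℝ B S y)
    (hB : ∀ᶠ z in 𝓝[S] y, ∀ u v, B z u v = G (ψ z) (A z u) (A z v)) (w u v : E) :
    fderivWithin ℝ B S y w u v
      = fderivWithin ℝ G S (ψ y) (A y w) (A y u) (A y v)
        + G (ψ y) (A' w u) (A y v) + G (ψ y) (A y u) (A' w v) := by
  have h1 := HasFDerivWithinAt.comp (g := G) (f := ψ) y hG.hasFDerivWithinAt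
    (hA.self_of_nhdsWithin hy) hψS
  have h2 := (h1.clm_apply (hA'.clm_apply (hasFDerivWithinAt_const u y S))).clm_apply
    (hA'.clm_apply (hasFDerivWithinAt_const v y S))
  have h3 := (hBd.hasFDerivWithinAt.clm_apply (hasFDerivWithinAt_const u y S)).clm_apply
    (hasFDerivWithinAt_const v y S)
  have hB' : (fun z => B z u v) =ᶠ[𝓝[S] y] fun z => G (ψ z) (A z u) (A z v) := by
    filter_upwards [hB] with z hz using hz u v
  have h4 := h2.congr_of_eventuallyEq hB' (hB'.eq_of_nhdsWithin hy)
  have h5 := congrArg (fun L : E →L[ℝ] ℝ => L w) ((hS y hy).eq h3 h4)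
  simp at h5
  rw [h5]
  ring

end Calculus

section

variable {N : ℕ} [NeZero N] {M : Type*} [TopologicalSpace M]
  [ChartedSpace (EuclideanHalfSpace N) M] [IsManifold (𝓡∂ N) ∞ M]

theorem uniqueDiffOn_range : UniqueDiffOn ℝ (range (𝓡∂ N)) := (𝓡∂ N).uniqueDiffOn

omit [IsManifold (𝓡∂ N) ∞ M] in
theorem extChartAt_mem_range (p x : M) : extChartAt (𝓡∂ N) p x ∈ range (𝓡∂ N) :=
  ⟨chartAt _ p x, rfl⟩

/-- The differential of the inverse of the preferred chart at `p`, read in preferred charts. -/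
def chartDeriv (p : M) (y : Model N) : Model N →L[ℝ] Model N :=
  mfderivWithin 𝓘(ℝ, Model N) (𝓡∂ N) (extChartAt (𝓡∂ N) p).symm (range (𝓡∂ N)) y

theorem chartMetric_apply (g : SmoothMetric N M) (p : M) (y u v : Model N) :
    chartMetric g p y u v = metricAt g ((extChartAt (𝓡∂ N) p).symm y)
      (chartDeriv p y u) (chartDeriv p y v) := rfl

theorem metricAt_symm (g : SmoothMetric N M) (x : M) (u v : Model N) :
    metricAt g x u v = metricAt g x v u := g.symm x u v

theorem contDiffOn_chartMetric (g : SmoothMetric N M) (p : M) :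
    ContDiffOn ℝ ∞ (chartMetric g p) (extChartAt (𝓡∂ N) p).target := by
  have : IsManifold (𝓡∂ N) 1 M := IsManifold.of_le (n := ∞) (by simp)
  rw [contDiffOn_clm_apply]
  intro u
  rw [contDiffOn_clm_apply]
  intro v
  set e := trivializationAt (Model N) (TangentSpace (𝓡∂ N) : M → Type _) p
  have hsec : ∀ w : Model N, ContMDiffOn (𝓡∂ N) ((𝓡∂ N).prod 𝓘(ℝ, Model N)) ∞
      (fun q => TotalSpace.mk' (Model N) q (e.symmL ℝ q w : TangentSpace (𝓡∂ N) q))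
      e.baseSet := by
    intro w
    have hc : ContMDiffOn (𝓡∂ N) ((𝓡∂ N).prod 𝓘(ℝ, Model N)) ∞
        (fun q : M => TotalSpace.mk' (Model N) (E := Bundle.Trivial M (Model N)) q w)
        e.baseSet := by
      intro q _
      exact (contMDiffAt_section q).2 contMDiffAt_const |>.contMDiffWithinAt
    exact (e.contMDiffOn_symmL (n := ∞) (IB := 𝓡∂ N)).clm_bundle_apply hc
  have h1 : ContMDiffOn (𝓡∂ N) 𝓘(ℝ, ℝ) ∞
      (fun q => g.inner q (e.symmL ℝ q u) (e.symmL ℝ q v)) e.baseSet := by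
    have := ContMDiffOn.clm_bundle_apply₂ (F₃ := ℝ) (E₃ := fun _ : M => ℝ)
      (g.contMDiff.contMDiffOn (s := e.baseSet)) (hsec u) (hsec v)
    intro q hq
    exact (contMDiffWithinAt_totalSpace.1 (this q hq)).2
  have h2 : ContMDiffOn 𝓘(ℝ, Model N) 𝓘(ℝ, ℝ) ∞ (fun y => chartMetric g p y u v)
      (extChartAt (𝓡∂ N) p).target := by
    refine (h1.comp (contMDiffOn_extChartAt_symm p) ?_).congr ?_
    · intro y hy
      simpa [e] using (extChartAt (𝓡∂ N) p).map_target hy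
    · intro y hy
      have hq : (extChartAt (𝓡∂ N) p).symm y ∈ (chartAt (EuclideanHalfSpace N) p).source := by
        simpa using (extChartAt (𝓡∂ N) p).map_target hy
      simp only [Function.comp]
      rw [TangentBundle.symmL_trivializationAt hq, (extChartAt (𝓡∂ N) p).right_inv hy]
      rfl
  exact h2.contDiffOn

theorem chartMetric_self (g : SmoothMetric N M) (x : M) :
    chartMetric g x (extChartAt (𝓡∂ N) x x) = metricAt g x := by
  have : IsManifold (𝓡∂ N) 1 M := IsManifold.of_le (n := ∞) (by simp)
  ext u v
  rw [chartMetric_apply, chartDeriv, mfderivWithin_range_extChartAt_symm, extChartAt_to_inv]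
  rfl

end

section

variable {N : ℕ} [NeZero N] {M : Type*} [TopologicalSpace M]
  [ChartedSpace (EuclideanHalfSpace N) M] [IsManifold (𝓡∂ N) ∞ M]

theorem contDiffWithinAt_comp_extChartAt_symm {f : M → ℝ} {x p : M}
    (hx : x ∈ (extChartAt (𝓡∂ N) p).source) (hf : ContMDiffAt (𝓡∂ N) 𝓘(ℝ, ℝ) ∞ f x) :
    ContDiffWithinAt ℝ ∞ (f ∘ (extChartAt (𝓡∂ N) p).symm) (range (𝓡∂ N))
      (extChartAt (𝓡∂ N) p x) := by
  rw [extChartAt_source] at hx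
  exact ((contMDiffAt_iff_of_mem_source (y := f x) hx (by simp)).1 hf).2

theorem eventually_differentiableWithinAt {E W : Type*} [NormedAddCommGroup E] [NormedSpace ℝ E]
    [NormedAddCommGroup W] [NormedSpace ℝ W] {F : E → W} {S : Set E} {y : E} (hy : y ∈ S)
    (hF : ContDiffWithinAt ℝ ∞ F S y) : ∀ᶠ z in 𝓝[S] y, DifferentiableWithinAt ℝ F S z := by
  have h := (hF.of_le (m := 1) (by simp)).eventually (by simp)
  rw [insert_eq_of_mem hy] at h
  filter_upwards [h] with z hz using hz.differentiableWithinAt (by simp)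

omit [IsManifold (𝓡∂ N) ∞ M] in
theorem differential_eq {f : M → ℝ} {x : M} (hf : MDifferentiableAt (𝓡∂ N) 𝓘(ℝ, ℝ) f x) :
    differential (N := N) f x =
      fderivWithin ℝ (f ∘ (extChartAt (𝓡∂ N) x).symm) (range (𝓡∂ N)) (extChartAt (𝓡∂ N) x x) := by
  rw [differential, hf.mfderiv]
  rfl

theorem differentiableWithinAt_chartMetric (g : SmoothMetric N M) {p x : M}
    (hx : x ∈ (extChartAt (𝓡∂ N) p).source) :
    DifferentiableWithinAt ℝ (chartMetric g p) (range (𝓡∂ N)) (extChartAt (𝓡∂ N) p x) := by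
  have h := (contDiffOn_chartMetric g p).differentiableOn (by simp) (extChartAt (𝓡∂ N) p x)
    ((extChartAt (𝓡∂ N) p).map_source hx)
  exact h.mono_of_mem_nhdsWithin (extChartAt_target_mem_nhdsWithin' hx)

theorem chartMetric_symm (g : SmoothMetric N M) (p : M) (y u v : Model N) :
    chartMetric g p y u v = chartMetric g p y v u := by
  rw [chartMetric_apply, chartMetric_apply, metricAt_symm]

/-- The Hessian in terms of the derivatives of the metric and the gradient. -/
theorem hess_eq (g : SmoothMetric N M) (f : M → ℝ) (x : M) (u : Model N) :
    hess g f x u u =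
      fderivWithin ℝ (fderivWithin ℝ (f ∘ (extChartAt (𝓡∂ N) x).symm) (range (𝓡∂ N)))
        (range (𝓡∂ N)) (extChartAt (𝓡∂ N) x x) u u
      - (chartMetricDeriv g x u u (grad g f x) - 1 / 2 * chartMetricDeriv g x (grad g f x) u u) := by
  rw [hess, ← metricAt_sharp g x (differential f x), metricAt_symm, christoffel, metricAt_sharp]
  simp [grad]
  ring

/-- The Hessian at `x` computed in the chart at `p`. -/
theorem exists_hess_eq (g : SmoothMetric N M) {f : M → ℝ} {x p : M}
    (hx : x ∈ (extChartAt (𝓡∂ N) p).source) (hf : ContMDiffAt (𝓡∂ N) 𝓘(ℝ, ℝ) ∞ f x) :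
    ∃ T : Model N →L[ℝ] Model N, Function.Surjective T ∧
      (∀ u v, metricAt g x u v = chartMetric g p (extChartAt (𝓡∂ N) p x) (T u) (T v)) ∧
      (∀ u, differential f x u = fderivWithin ℝ (f ∘ (extChartAt (𝓡∂ N) p).symm) (range (𝓡∂ N))
        (extChartAt (𝓡∂ N) p x) (T u)) ∧
      ∀ u, hess g f x u u =
        fderivWithin ℝ (fderivWithin ℝ (f ∘ (extChartAt (𝓡∂ N) p).symm) (range (𝓡∂ N)))
          (range (𝓡∂ N)) (extChartAt (𝓡∂ N) p x) (T u) (T u)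
        - (fderivWithin ℝ (chartMetric g p) (range (𝓡∂ N)) (extChartAt (𝓡∂ N) p x)
            (T u) (T u) (T (grad g f x))
          - 1 / 2 * fderivWithin ℝ (chartMetric g p) (range (𝓡∂ N)) (extChartAt (𝓡∂ N) p x)
            (T (grad g f x)) (T u) (T u)) := by
  have : IsManifold (𝓡∂ N) 1 M := IsManifold.of_le (n := ∞) (by simp)
  set S : Set (Model N) := range (𝓡∂ N) with hSdef
  set F := f ∘ (extChartAt (𝓡∂ N) p).symm with hFdef
  set y := extChartAt (𝓡∂ N) x x with hydef
  set ψ := extChartAt (𝓡∂ N) p ∘ (extChartAt (𝓡∂ N) x).symm with hψdef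
  have hS : UniqueDiffOn ℝ S := uniqueDiffOn_range
  have hyS : y ∈ S := extChartAt_mem_range x x
  have hψS : MapsTo ψ S S := fun z _ => extChartAt_mem_range p _
  have hψy : ψ y = extChartAt (𝓡∂ N) p x := by
    simp only [hψdef, hydef, Function.comp, extChartAt_to_inv]
  have hψ : ContDiffWithinAt ℝ ∞ ψ S y :=
    contDiffWithinAt_ext_coord_change (I := 𝓡∂ N) p x (by
      refine ⟨(extChartAt (𝓡∂ N) x).map_source (mem_extChartAt_source x), ?_⟩
      rwa [mem_preimage, PartialEquiv.symm_symm, hydef, extChartAt_to_inv])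
  have hmem : ∀ᶠ z in 𝓝[S] y, z ∈ (extChartAt (𝓡∂ N) x).target ∧
      (extChartAt (𝓡∂ N) x).symm z ∈ (extChartAt (𝓡∂ N) p).source := by
    refine (show ∀ᶠ z in 𝓝[S] y, z ∈ (extChartAt (𝓡∂ N) x).target from
      extChartAt_target_mem_nhdsWithin x).and ?_
    refine nhdsWithin_le_nhds ((continuousAt_extChartAt_symm x).eventually_mem ?_)
    rw [extChartAt_to_inv]
    exact extChartAt_source_mem_nhds' hx
  have hψd := eventually_differentiableWithinAt hyS hψ
  set A := fderivWithin ℝ ψ S with hAdef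
  have hA : ∀ᶠ z in 𝓝[S] y, HasFDerivWithinAt ψ (A z) S z := by
    filter_upwards [hψd] with z hz using hz.hasFDerivWithinAt
  have hA' : HasFDerivWithinAt A (fderivWithin ℝ A S y) S y :=
    ((hψ.fderivWithin_right (m := 1) hS (by norm_cast) hyS).differentiableWithinAt
      (by simp)).hasFDerivWithinAt
  set A' := fderivWithin ℝ A S y with hA'def
  have hsymm : ∀ u v, A' u v = A' v u := fun u v =>
    hψ.isSymmSndFDerivWithinAt (by simp; norm_cast) hS ((𝓡∂ N).range_subset_closure_interior hyS) hyS u v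
  have hF : ContDiffWithinAt ℝ ∞ F S (ψ y) := hψy ▸ contDiffWithinAt_comp_extChartAt_symm hx hf
  have hFd := eventually_differentiableWithinAt (hψS hyS) hF
  have hF' : DifferentiableWithinAt ℝ (fderivWithin ℝ F S) S (ψ y) :=
    (hF.fderivWithin_right (m := 1) hS (by norm_cast) (hψS hyS)).differentiableWithinAt (by simp)
  have hfF : f ∘ (extChartAt (𝓡∂ N) x).symm =ᶠ[𝓝[S] y] F ∘ ψ := by
    filter_upwards [hmem] with z hz
    simp only [hFdef, hψdef, Function.comp, (extChartAt (𝓡∂ N) p).left_inv hz.2]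
  have hG : DifferentiableWithinAt ℝ (chartMetric g p) S (ψ y) :=
    hψy ▸ differentiableWithinAt_chartMetric g hx
  have hB : ∀ᶠ z in 𝓝[S] y, ∀ u v,
      chartMetric g x z u v = chartMetric g p (ψ z) (A z u) (A z v) := by
    filter_upwards [hmem, eventually_eventually_nhdsWithin.2 hmem, hψd, self_mem_nhdsWithin]
      with z hz hz' hψz hzS u v
    have heq : (extChartAt (𝓡∂ N) x).symm =ᶠ[𝓝[S] z] (extChartAt (𝓡∂ N) p).symm ∘ ψ := by
      filter_upwards [hz'] with w hw
      simp only [hψdef, Function.comp, (extChartAt (𝓡∂ N) p).left_inv hw.2]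
    have hval : (extChartAt (𝓡∂ N) p).symm (ψ z) = (extChartAt (𝓡∂ N) x).symm z := by
      simp only [hψdef, Function.comp, (extChartAt (𝓡∂ N) p).left_inv hz.2]
    have hder : ∀ w : Model N, chartDeriv x z w = chartDeriv p (ψ z) (A z w) := by
      intro w
      rw [chartDeriv, heq.mfderivWithin_eq (heq.eq_of_nhdsWithin hzS),
        mfderivWithin_comp (I' := 𝓘(ℝ, Model N)) (u := S) z
          (mdifferentiableWithinAt_extChartAt_symm ((extChartAt (𝓡∂ N) p).map_source hz.2))
          hψz.mdifferentiableWithinAt (fun w hw => hψS hw) (hS z hzS).uniqueMDiffWithinAt,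
        mfderivWithin_eq_fderivWithin]
      rfl
    rw [chartMetric_apply, chartMetric_apply, hval, hder, hder]
  have hmetric : ∀ u v, metricAt g x u v = chartMetric g p (ψ y) (A y u) (A y v) := by
    intro u v
    rw [← chartMetric_self g x]
    exact hB.self_of_nhdsWithin hyS u v
  have hinj : Function.Injective (A y) := by
    rw [injective_iff_map_eq_zero]
    intro u hu
    by_contra hne
    have := metricAt_pos g x u hne
    rw [hmetric, hu] at this
    simp at this
  have hsurj : Function.Surjective (A y) :=
    LinearMap.injective_iff_surjective (f := (A y).toLinearMap).1 hinj
  have hdiff : ∀ u, differential f x u = fderivWithin ℝ F S (ψ y) (A y u) := by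
    intro u
    rw [differential_eq (hf.mdifferentiableAt (by simp)),
      (eventually_fderivWithin_comp hS hψS hyS hA hFd hfF).eq_of_nhdsWithin hyS]
    rfl
  refine ⟨A y, hsurj, ?_, ?_, ?_⟩
  · simpa only [hψy] using hmetric
  · simpa only [hψy] using hdiff
  intro u
  set c := grad g f x
  have hgrad : ∀ w, fderivWithin ℝ F S (ψ y) w = chartMetric g p (ψ y) (A y c) w := by
    intro w
    obtain ⟨v, rfl⟩ := hsurj w
    rw [← hdiff, ← hmetric]
    exact (metricAt_sharp g x _ v).symm
  have hD := fderivWithin_bilinearComp hS hψS hyS hA hA' hG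
    (differentiableWithinAt_chartMetric g (mem_extChartAt_source x)) hB
  rw [hess_eq, chartMetricDeriv, hD, hD,
    fderivWithin_fderivWithin_comp hS hψS hyS hA hA' hFd hF' hfF, hgrad, hsymm c u,
    chartMetric_symm g p _ (A y c), chartMetric_symm g p _ (A' u c), ← hψy]
  ring

end

/-! ### Local escape functions -/

/-- A positive definite bilinear form on a finite-dimensional space is coercive. -/
theorem exists_coercive {E : Type*} [NormedAddCommGroup E] [NormedSpace ℝ E]
    [FiniteDimensional ℝ E] (B : E →L[ℝ] E →L[ℝ] ℝ) (hB : ∀ v, v ≠ 0 → 0 < B v v) :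
    ∃ α : ℝ, 0 < α ∧ ∀ v, α * ‖v‖ ^ 2 ≤ B v v := by
  have hcont : Continuous fun v => B v v := by fun_prop
  rcases (Metric.sphere (0 : E) 1).eq_empty_or_nonempty with h | h
  · refine ⟨1, one_pos, fun v => ?_⟩
    have hv : v = 0 := by
      by_contra hv
      have : ‖v‖⁻¹ • v ∈ Metric.sphere (0 : E) 1 := by simp [norm_smul, hv]
      simp [h] at this
    simp [hv]
  · obtain ⟨w, hw, hmin⟩ := (isCompact_sphere (0 : E) 1).exists_isMinOn h hcont.continuousOn
    have hw0 : w ≠ 0 := by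
      rintro rfl
      simp at hw
    refine ⟨B w w, hB w hw0, fun v => ?_⟩
    by_cases hv : v = 0
    · simp [hv]
    have h1 : ‖v‖⁻¹ • v ∈ Metric.sphere (0 : E) 1 := by simp [norm_smul, hv]
    have h2 : B w w ≤ B (‖v‖⁻¹ • v) (‖v‖⁻¹ • v) := hmin h1
    have h3 : 0 < ‖v‖ := norm_pos_iff.2 hv
    have h4 : B (‖v‖⁻¹ • v) (‖v‖⁻¹ • v) * ‖v‖ ^ 2 = B v v := by
      simp
      field_simp
    rw [← h4]
    gcongr

set_option maxSynthPendingDepth 3 in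
/-- Uniform bounds near `a` for a field of bilinear forms that is positive definite at `a`. -/
theorem exists_eventually_bounds {E : Type*} [NormedAddCommGroup E] [NormedSpace ℝ E]
    [FiniteDimensional ℝ E] {G : E → E →L[ℝ] E →L[ℝ] ℝ} {S : Set E} {a : E}
    (hS : UniqueDiffOn ℝ S) (haS : a ∈ S) (hG : ContDiffWithinAt ℝ ∞ G S a)
    (hpos : ∀ v, v ≠ 0 → 0 < G a v v) :
    ∃ α β b : ℝ, 0 < α ∧ 0 < β ∧ 0 ≤ b ∧ ∀ᶠ y in 𝓝[S] a,
      (∀ w, α * ‖w‖ ^ 2 ≤ G y w w) ∧ (∀ v w, G y v w ≤ β * ‖v‖ * ‖w‖) ∧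
        ∀ u v w, |fderivWithin ℝ G S y u v w| ≤ b * ‖u‖ * ‖v‖ * ‖w‖ := by
  have hG0 := hG.continuousWithinAt
  have hG1 := (hG.fderivWithin_right (m := 0) hS (by norm_cast) haS).continuousWithinAt
  obtain ⟨α, hα, hcoer⟩ := exists_coercive (G a) hpos
  refine ⟨α / 2, ‖G a‖ + 1, ‖fderivWithin ℝ G S a‖ + 1,
    by positivity, by positivity, by positivity, ?_⟩
  have e1 : ∀ᶠ y in 𝓝[S] a, ‖G y - G a‖ < α / 2 := by
    have h := (hG0.sub (continuousWithinAt_const (b := G a))).norm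
    refine h.eventually_lt continuousWithinAt_const ?_
    simpa using hα
  have e2 : ∀ᶠ y in 𝓝[S] a, ‖G y‖ < ‖G a‖ + 1 :=
    hG0.norm.eventually_lt continuousWithinAt_const (by linarith)
  have e3 : ∀ᶠ y in 𝓝[S] a, ‖fderivWithin ℝ G S y‖ < ‖fderivWithin ℝ G S a‖ + 1 :=
    hG1.norm.eventually_lt continuousWithinAt_const (by linarith)
  filter_upwards [e1, e2, e3] with y h1 h2 h3
  refine ⟨fun w => ?_, fun v w => ?_, fun u v w => ?_⟩
  · have h4 := (G y - G a).le_opNorm₂ w w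
    have h5 := (abs_le.1 h4).1
    simp only [sub_apply] at h5
    have h6 := hcoer w
    have h7 : ‖G y - G a‖ * ‖w‖ * ‖w‖ ≤ α / 2 * ‖w‖ * ‖w‖ := by gcongr
    nlinarith
  · refine (le_abs_self _).trans (((G y).le_opNorm₂ v w).trans ?_)
    gcongr
  · refine ((fderivWithin ℝ G S y u).le_opNorm₂ v w).trans ?_
    have h4 := (fderivWithin ℝ G S y).le_opNorm u
    have h5 : ‖fderivWithin ℝ G S y‖ * ‖u‖ ≤ (‖fderivWithin ℝ G S a‖ + 1) * ‖u‖ := by gcongr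
    have h6 := h4.trans h5
    gcongr

/-- Bounds for the vector `c` that represents the covector `L`, and for a Hessian. -/
theorem hessian_estimates {E : Type*} [NormedAddCommGroup E] [NormedSpace ℝ E]
    {G : E →L[ℝ] E →L[ℝ] ℝ} {D : E →L[ℝ] E →L[ℝ] E →L[ℝ] ℝ} {L : E →L[ℝ] ℝ} {c e : E}
    {α β b l : ℝ} (hα : 0 < α) (hβ : 0 < β) (hb : 0 ≤ b) (hG : ∀ w, α * ‖w‖ ^ 2 ≤ G w w)
    (hGβ : ∀ v w, G v w ≤ β * ‖v‖ * ‖w‖) (hD : ∀ u v w, |D u v w| ≤ b * ‖u‖ * ‖v‖ * ‖w‖)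
    (hc : ∀ w, G c w = L w) (hL : ∀ w, L w ≤ 2 * ‖w‖) (he : ‖e‖ = 1) (hLe : 1 / 2 ≤ L e)
    (hl : 3 * b / α + β ≤ l) :
    α * (1 / (2 * β)) ^ 2 ≤ G c c ∧
      ∀ w, G w w ≤ l * ‖w‖ ^ 2 - (D w w c - 1 / 2 * D c w w) := by
  have h1 : 1 / (2 * β) ≤ ‖c‖ := by
    have := hGβ c e
    rw [hc, he] at this
    rw [div_le_iff₀ (by positivity)]
    linarith
  have h2 : ‖c‖ ≤ 2 / α := by
    have h3 := (hG c).trans ((hc c).le.trans (hL c))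
    have h4 : 0 < ‖c‖ := lt_of_lt_of_le (by positivity) h1
    rw [le_div_iff₀ hα]
    nlinarith
  refine ⟨(by gcongr : α * (1 / (2 * β)) ^ 2 ≤ α * ‖c‖ ^ 2).trans (hG c), fun w => ?_⟩
  have h5 := (abs_le.1 (hD w w c)).2
  have h6 := (abs_le.1 (hD c w w)).1
  have h7 : b * ‖w‖ * ‖w‖ * ‖c‖ ≤ b * ‖w‖ * ‖w‖ * (2 / α) := by gcongr
  have h8 : (3 * b / α + β) * ‖w‖ ^ 2 ≤ l * ‖w‖ ^ 2 := by gcongr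
  have h9 := hGβ w w
  have h10 : (3 * b / α) * ‖w‖ ^ 2 = 3 / 2 * (b * ‖w‖ * ‖w‖ * (2 / α)) := by
    field_simp
  nlinarith

section

variable {N : ℕ} [NeZero N]

/-- A quadratic function with gradient `e₀` at `a`. -/
def quadratic (a : Model N) (l : ℝ) (y : Model N) : ℝ :=
  2 + normalCoord (y - a) + l / 2 * ‖y - a‖ ^ 2

theorem contDiff_quadratic (a : Model N) (l : ℝ) : ContDiff ℝ ∞ (quadratic a l) := by
  unfold quadratic
  have : ContDiff ℝ ∞ fun y : Model N => ‖y - a‖ ^ 2 := (contDiff_id.sub contDiff_const).norm_sq ℝ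
  fun_prop

theorem hasFDerivAt_quadratic (a : Model N) (l : ℝ) (y : Model N) :
    HasFDerivAt (quadratic a l) (normalCoord + l • innerSL ℝ (y - a)) y := by
  have h1 : HasFDerivAt (fun y : Model N => y - a) (ContinuousLinearMap.id ℝ _) y :=
    (hasFDerivAt_id y).sub_const a
  have h2 := ((normalCoord (N := N)).hasFDerivAt.comp y h1).const_add 2
  have h3 := h2.add (h1.norm_sq.const_mul (l / 2))
  refine h3.congr_fderiv ?_
  ext v
  simp
  ring

theorem fderivWithin_quadratic {S : Set (Model N)} (hS : UniqueDiffOn ℝ S) {y : Model N}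
    (hy : y ∈ S) (a : Model N) (l : ℝ) :
    fderivWithin ℝ (quadratic a l) S y = normalCoord + l • innerSL ℝ (y - a) :=
  (hasFDerivAt_quadratic a l y).hasFDerivWithinAt.fderivWithin (hS y hy)

theorem fderivWithin_fderivWithin_quadratic {S : Set (Model N)} (hS : UniqueDiffOn ℝ S)
    {y : Model N} (hy : y ∈ S) (a : Model N) (l : ℝ) (u : Model N) :
    fderivWithin ℝ (fderivWithin ℝ (quadratic a l) S) S y u u = l * ‖u‖ ^ 2 := by
  have h1 : HasFDerivAt (fun y : Model N => normalCoord + l • innerSL ℝ (y - a))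
      (l • innerSL ℝ) y :=
    (((innerSL ℝ (E := Model N)).hasFDerivAt.comp y
      ((hasFDerivAt_id y).sub_const a)).const_smul l).const_add normalCoord
  have h2 := h1.hasFDerivWithinAt.congr (s := S)
    (fun z hz => fderivWithin_quadratic hS hz a l) (fderivWithin_quadratic hS hy a l)
  rw [h2.fderivWithin (hS y hy), ← real_inner_self_eq_norm_sq]
  rfl

theorem abs_normalCoord_le (v : Model N) : |normalCoord v| ≤ ‖v‖ :=
  PiLp.norm_apply_le v 0

variable {M : Type*} [TopologicalSpace M]
  [ChartedSpace (EuclideanHalfSpace N) M] [IsManifold (𝓡∂ N) ∞ M]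

theorem exists_chartMetric_bounds (g : SmoothMetric N M) (p : M) :
    ∃ α β b : ℝ, 0 < α ∧ 0 < β ∧ 0 ≤ b ∧
      ∀ᶠ y in 𝓝[range (𝓡∂ N)] (extChartAt (𝓡∂ N) p p),
        (∀ w, α * ‖w‖ ^ 2 ≤ chartMetric g p y w w) ∧
        (∀ v w, chartMetric g p y v w ≤ β * ‖v‖ * ‖w‖) ∧
        ∀ u v w, |fderivWithin ℝ (chartMetric g p) (range (𝓡∂ N)) y u v w|
          ≤ b * ‖u‖ * ‖v‖ * ‖w‖ := by
  refine exists_eventually_bounds uniqueDiffOn_range (extChartAt_mem_range p p)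
    ((contDiffOn_chartMetric g p _ (mem_extChartAt_target p)).mono_of_mem_nhdsWithin
      (extChartAt_target_mem_nhdsWithin p)) fun v hv => ?_
  rw [chartMetric_self]
  exact metricAt_pos g p v hv

/-- Every point has a neighbourhood with an escape function. -/
theorem exists_local_escape [T2Space M] (g : SmoothMetric N M) (p : M) :
    ∃ f : M → ℝ, ContMDiff (𝓡∂ N) 𝓘(ℝ, ℝ) ∞ f ∧ ∃ U ∈ 𝓝 p, HessGeOn g f U ∧
      PosInfOn (fun x => tnorm g x (grad g f x)) U ∧ PosInfOn f U := by
  obtain ⟨α, β, b, hα, hβ, hb, hbounds⟩ := exists_chartMetric_bounds g p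
  set S : Set (Model N) := range (𝓡∂ N) with hSdef
  have hS : UniqueDiffOn ℝ S := uniqueDiffOn_range
  set a : Model N := extChartAt (𝓡∂ N) p p with hadef
  set l : ℝ := 3 * b / α + β + 1 with hl
  have hl1 : 1 ≤ l := by
    have : 0 ≤ 3 * b / α := by positivity
    linarith
  set Q : Model N → ℝ := quadratic a l
  let χ : SmoothBumpFunction (𝓡∂ N) p := Classical.arbitrary _
  set f : M → ℝ := fun x => χ x • Q (extChartAt (𝓡∂ N) p x)
  have hf : ContMDiff (𝓡∂ N) 𝓘(ℝ, ℝ) ∞ f :=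
    χ.contMDiff_smul ((contDiff_quadratic a l).contMDiff.comp_contMDiffOn contMDiffOn_extChartAt)
  have hfQ : f =ᶠ[𝓝 p] Q ∘ extChartAt (𝓡∂ N) p := by
    filter_upwards [χ.eventuallyEq_one] with x hx
    simp [f, hx]
  have htend : Filter.Tendsto (extChartAt (𝓡∂ N) p) (𝓝 p) (𝓝[S] a) :=
    tendsto_nhdsWithin_iff.2 ⟨(continuousAt_extChartAt p).tendsto,
      Filter.Eventually.of_forall fun x => extChartAt_mem_range p x⟩
  have hball : ∀ᶠ y in 𝓝[S] a, ‖y - a‖ < 1 / (2 * l) := by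
    have : Metric.ball a (1 / (2 * l)) ∈ 𝓝[S] a :=
      nhdsWithin_le_nhds (Metric.ball_mem_nhds a (by positivity))
    filter_upwards [this] with y hy
    simpa [dist_eq_norm] using hy
  refine ⟨f, hf, _, Filter.inter_mem (Filter.inter_mem (extChartAt_source_mem_nhds (I := 𝓡∂ N) p)
    hfQ.eventually_nhds) (htend.eventually (hbounds.and hball)), ?_⟩
  have key : ∀ x, x ∈ (extChartAt (𝓡∂ N) p).source → f =ᶠ[𝓝 x] Q ∘ extChartAt (𝓡∂ N) p →
      (∀ w, α * ‖w‖ ^ 2 ≤ chartMetric g p (extChartAt (𝓡∂ N) p x) w w) →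
      (∀ v w, chartMetric g p (extChartAt (𝓡∂ N) p x) v w ≤ β * ‖v‖ * ‖w‖) →
      (∀ u v w, |fderivWithin ℝ (chartMetric g p) S (extChartAt (𝓡∂ N) p x) u v w|
          ≤ b * ‖u‖ * ‖v‖ * ‖w‖) → ‖extChartAt (𝓡∂ N) p x - a‖ < 1 / (2 * l) →
      (∀ X : Model N, tnorm g x X ^ 2 ≤ hess g f x X X) ∧
        √(α * (1 / (2 * β)) ^ 2) ≤ tnorm g x (grad g f x) ∧ 1 ≤ f x := by
    intro x hx hfx hG hGβ hD hya
    obtain ⟨T, hT, hTm, hTd, hTh⟩ := exists_hess_eq g hx (hf x)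
    set y : Model N := extChartAt (𝓡∂ N) p x with hydef
    have hyS : y ∈ S := extChartAt_mem_range p x
    have hfy : f ∘ (extChartAt (𝓡∂ N) p).symm =ᶠ[𝓝[S] y] Q := by
      have h1 : Filter.Tendsto (extChartAt (𝓡∂ N) p).symm (𝓝[S] y) (𝓝 x) := by
        have := (continuousAt_extChartAt_symm' hx).tendsto
        rw [(extChartAt (𝓡∂ N) p).left_inv hx] at this
        exact this.mono_left nhdsWithin_le_nhds
      filter_upwards [h1.eventually hfx, extChartAt_target_mem_nhdsWithin' hx] with z hz hz'
      simp only [Function.comp] at hz ⊢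
      rw [hz, (extChartAt (𝓡∂ N) p).right_inv hz']
    have hfy1 := hfy.fderivWithin (𝕜 := ℝ)
    have hfy0 := hfy1.eq_of_nhdsWithin hyS
    have hfy2 := (hfy1.fderivWithin (𝕜 := ℝ)).eq_of_nhdsWithin hyS
    rw [hfy0, fderivWithin_quadratic hS hyS] at hTd
    rw [hfy2] at hTh
    have hc : ∀ w, chartMetric g p y (T (grad g f x)) w
        = (normalCoord + l • innerSL ℝ (y - a) : Model N →L[ℝ] ℝ) w := by
      intro w
      obtain ⟨v, rfl⟩ := hT w
      rw [← hTm, ← hTd]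
      exact metricAt_sharp g x _ v
    have hly : l * ‖y - a‖ ≤ 1 / 2 := by
      rw [lt_div_iff₀ (by positivity)] at hya
      linarith
    have hinner : ∀ w, |l * inner ℝ (y - a) w| ≤ 1 / 2 * ‖w‖ := by
      intro w
      rw [abs_mul, abs_of_pos (by linarith : 0 < l)]
      calc l * |inner ℝ (y - a) w| ≤ l * (‖y - a‖ * ‖w‖) := by
            gcongr
            exact abs_real_inner_le_norm _ _
        _ = (l * ‖y - a‖) * ‖w‖ := by ring
        _ ≤ 1 / 2 * ‖w‖ := by gcongr
    set e : Model N := EuclideanSpace.single 0 1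
    have he : ‖e‖ = 1 := by simp [e]
    have hest := hessian_estimates hα hβ hb hG hGβ hD hc (e := e) (l := l) (fun w => by
        have h1 := (abs_le.1 (hinner w)).2
        have h2 := (abs_le.1 (abs_normalCoord_le w)).2
        have h3 : (normalCoord + l • innerSL ℝ (y - a) : Model N →L[ℝ] ℝ) w
          = normalCoord w + l * inner ℝ (y - a) w := rfl
        rw [h3]
        linarith [norm_nonneg w]) he (by
        have h1 := (abs_le.1 (hinner e)).1
        have h2 : normalCoord e = 1 := by simp [normalCoord, e]
        have h3 : (normalCoord + l • innerSL ℝ (y - a) : Model N →L[ℝ] ℝ) e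
          = normalCoord e + l * inner ℝ (y - a) e := rfl
        rw [h3, h2]
        rw [he] at h1
        linarith) (by linarith)
    have hpos : ∀ u, 0 ≤ metricAt g x u u := fun u => by
      rw [hTm]
      exact le_trans (by positivity) (hG _)
    refine ⟨fun X => ?_, ?_, ?_⟩
    · rw [hTh, fderivWithin_fderivWithin_quadratic hS hyS, tnorm, Real.sq_sqrt (hpos X), hTm]
      exact hest.2 (T X)
    · rw [tnorm, hTm]
      exact Real.sqrt_le_sqrt hest.1
    · have h1 : f x = Q y := hfx.eq_of_nhds
      have h2 := (abs_le.1 (abs_normalCoord_le (y - a))).1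
      have h3 : ‖y - a‖ ≤ l * ‖y - a‖ := le_mul_of_one_le_left (norm_nonneg _) hl1
      have h4 : 0 ≤ l / 2 * ‖y - a‖ ^ 2 := by positivity
      rw [h1]
      simp only [Q, quadratic]
      linarith
  exact ⟨fun x hx => (key x hx.1.1 hx.1.2 hx.2.1.1 hx.2.1.2.1 hx.2.1.2.2 hx.2.2).1,
    ⟨_, by positivity, fun x hx => (key x hx.1.1 hx.1.2 hx.2.1.1 hx.2.1.2.1 hx.2.1.2.2 hx.2.2).2.1⟩,
    ⟨1, one_pos, fun x hx => (key x hx.1.1 hx.1.2 hx.2.1.1 hx.2.1.2.1 hx.2.1.2.2 hx.2.2).2.2⟩⟩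

end

/-! ### Connected open sets -/

section Topology

variable {X : Type*} [TopologicalSpace X]

/-- A compact subset of a connected open set `W` lies in a connected open set whose closure is
contained in `W`. -/
theorem exists_isConnected_between [LocallyConnectedSpace X] [RegularSpace X] {K W : Set X}
    (hK : IsCompact K) (hW : IsOpen W) (hWc : IsConnected W) (hKW : K ⊆ W) :
    ∃ Ω, IsOpen Ω ∧ IsConnected Ω ∧ K ⊆ Ω ∧ closure Ω ⊆ W := by
  have hloc : ∀ x ∈ W, ∃ B, IsOpen B ∧ IsConnected B ∧ x ∈ B ∧ closure B ⊆ W := by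
    intro x hx
    obtain ⟨C, ⟨hCx, hCc⟩, hCW⟩ := (closed_nhds_basis x).mem_iff.1 (hW.mem_nhds hx)
    obtain ⟨B, ⟨hBo, hxB, hBc⟩, hBC⟩ :=
      (LocallyConnectedSpace.open_connected_basis x).mem_iff.1 hCx
    exact ⟨B, hBo, hBc, hxB, (closure_minimal hBC hCc).trans hCW⟩
  obtain ⟨x₀, hx₀⟩ := hWc.nonempty
  let 𝒞 := {U : Set X // IsOpen U ∧ IsConnected U ∧ x₀ ∈ U ∧ closure U ⊆ W}
  obtain ⟨B₀, hB₀⟩ := hloc x₀ hx₀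
  have hne : Nonempty 𝒞 := ⟨⟨B₀, hB₀⟩⟩
  set A : Set X := ⋃ U : 𝒞, U.1 with hA
  have hAo : IsOpen A := isOpen_iUnion fun U => U.2.1
  have hWA : W ⊆ A := by
    refine hWc.isPreconnected.subset_of_closure_inter_subset hAo
      ⟨x₀, hx₀, mem_iUnion.2 ⟨⟨B₀, hB₀⟩, hB₀.2.2.1⟩⟩ ?_
    rintro x ⟨hxA, hxW⟩
    obtain ⟨B, hBo, hBc, hxB, hBW⟩ := hloc x hxW
    obtain ⟨z, hzB, hzA⟩ := mem_closure_iff.1 hxA B hBo hxB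
    obtain ⟨U, hzU⟩ := mem_iUnion.1 hzA
    refine mem_iUnion.2 ⟨⟨U.1 ∪ B, U.2.1.union hBo, U.2.2.1.union ⟨z, hzU, hzB⟩ hBc,
      Or.inl U.2.2.2.1, ?_⟩, Or.inr hxB⟩
    rw [closure_union]
    exact union_subset U.2.2.2.2 hBW
  obtain ⟨U, hU⟩ := hK.elim_directed_cover (fun U : 𝒞 => U.1) (fun U => U.2.1)
    (hKW.trans hWA) fun U U' =>
      ⟨⟨U.1 ∪ U'.1, U.2.1.union U'.2.1, U.2.2.1.union ⟨x₀, U.2.2.2.1, U'.2.2.2.1⟩ U'.2.2.1,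
        Or.inl U.2.2.2.1, by
          rw [closure_union]
          exact union_subset U.2.2.2.2 U'.2.2.2.2⟩, subset_union_left, subset_union_right⟩
  exact ⟨U.1, U.2.1, U.2.2.1, hU, U.2.2.2.2⟩

/-- The members of a cover of a connected space by at least two nonempty open sets overlap. -/
theorem exists_inter_nonempty_of_cover [PreconnectedSpace X] {k : ℕ} (hk : 2 ≤ k)
    {Ω : Fin k → Set X} (ho : ∀ j, IsOpen (Ω j)) (hne : ∀ j, (Ω j).Nonempty)
    (hcov : ⋃ j, Ω j = univ) (j : Fin k) : ∃ i, i ≠ j ∧ (Ω j ∩ Ω i).Nonempty := by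
  have : Nontrivial (Fin k) := Fin.nontrivial_iff_two_le.2 hk
  obtain ⟨i₀, hi₀⟩ := exists_ne j
  obtain ⟨x, hx⟩ := hne i₀
  have h := nonempty_inter (ho j) (isOpen_biUnion fun i (_ : i ≠ j) => ho i) ?_ (hne j)
    ⟨x, mem_biUnion hi₀ hx⟩
  · obtain ⟨z, hz, hz'⟩ := h
    obtain ⟨i, hi, hzi⟩ := mem_iUnion₂.1 hz'
    exact ⟨i, hi, z, hz, hzi⟩
  · refine eq_univ_of_forall fun z => ?_
    obtain ⟨i, hi⟩ := mem_iUnion.1 (hcov.symm ▸ mem_univ z : z ∈ ⋃ j, Ω j)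
    by_cases hij : i = j
    · exact Or.inl (hij ▸ hi)
    · exact Or.inr (mem_biUnion hij hi)

theorem inter_nonempty_of_isPieces [PreconnectedSpace X] {m : ℕ} {V R : Set X}
    {Vj : Fin m → Set X} (hV : IsPieces V Vj) (hR : IsOpen R) (hVR : Vᶜ ⊆ R) {j : Fin m}
    (hj : Vj j ≠ univ) : (Vj j ∩ R).Nonempty := by
  have hfr : (frontier (Vj j)).Nonempty :=
    nonempty_frontier_iff.2 ⟨(hV.isConnected j).nonempty, hj⟩
  obtain ⟨x, hx⟩ := hfr
  rw [(hV.isOpen j).frontier_eq] at hx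
  have hxV : x ∈ Vᶜ := by
    rw [← hV.iUnion]
    intro hxV
    obtain ⟨i, hi⟩ := mem_iUnion.1 hxV
    obtain ⟨z, hzi, hzj⟩ := mem_closure_iff.1 hx.1 _ (hV.isOpen i) hi
    by_cases hij : i = j
    · exact hx.2 (hij ▸ hi)
    · exact disjoint_left.1 (hV.disjoint hij) hzi hzj
  obtain ⟨z, hzR, hzj⟩ := mem_closure_iff.1 hx.1 R hR (hVR hxV)
  exact ⟨z, hzj, hzR⟩

end Topology

theorem locallyConnectedSpace_halfSpace (N : ℕ) [NeZero N] :
    LocallyConnectedSpace (EuclideanHalfSpace N) := by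
  have : LocallyPathConnectedSpace (EuclideanHalfSpace N) :=
    Convex.locallyPathConnectedSpace (EuclideanSpace ℝ (Fin N)) EuclideanHalfSpace.convex
  infer_instance

section

variable {N : ℕ} [NeZero N] {M : Type*} [TopologicalSpace M]
  [ChartedSpace (EuclideanHalfSpace N) M] [IsManifold (𝓡∂ N) ∞ M]

/-! ### Locality -/

omit [IsManifold (𝓡∂ N) ∞ M] in
theorem differential_congr {f f' : M → ℝ} {x : M} (h : f =ᶠ[𝓝 x] f') :
    differential (N := N) f x = differential f' x :=
  h.mfderiv_eq

theorem grad_congr (g : SmoothMetric N M) {f f' : M → ℝ} {x : M} (h : f =ᶠ[𝓝 x] f') :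
    grad g f x = grad g f' x := by
  rw [grad, grad, differential_congr h]

theorem hess_congr (g : SmoothMetric N M) {f f' : M → ℝ} {x : M} (h : f =ᶠ[𝓝 x] f') :
    hess g f x = hess g f' x := by
  have h1 : Filter.Tendsto (extChartAt (𝓡∂ N) x).symm
      (𝓝[range (𝓡∂ N)] (extChartAt (𝓡∂ N) x x)) (𝓝 x) := by
    have := (continuousAt_extChartAt_symm (I := 𝓡∂ N) x).tendsto
    rw [extChartAt_to_inv] at this
    exact this.mono_left nhdsWithin_le_nhds
  have h2 : f ∘ (extChartAt (𝓡∂ N) x).symm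
      =ᶠ[𝓝[range (𝓡∂ N)] (extChartAt (𝓡∂ N) x x)] f' ∘ (extChartAt (𝓡∂ N) x).symm :=
    h1.eventually h
  ext u v
  rw [hess, hess, differential_congr h, ((h2.fderivWithin (𝕜 := ℝ)).fderivWithin
    (𝕜 := ℝ)).eq_of_nhdsWithin (extChartAt_mem_range x x)]

/-! ### The maximum principle -/

theorem mem_range_iff {y : Model N} : y ∈ range (𝓡∂ N) ↔ 0 ≤ normalCoord y := by
  have h : range (𝓡∂ N) = {y : Model N | 0 ≤ y 0} := range_modelWithCornersEuclideanHalfSpace N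
  rw [h]
  rfl

omit [IsManifold (𝓡∂ N) ∞ M] in
/-- At a maximum point of `f` the differential is nonpositive on inward vectors. -/
theorem differential_nonpos_of_isMax {f : M → ℝ} {x : M}
    (hf : MDifferentiableAt (𝓡∂ N) 𝓘(ℝ, ℝ) f x) (hmax : ∀ z, f z ≤ f x) {v : Model N}
    (hv : v ∈ posTangentConeAt (range (𝓡∂ N)) (extChartAt (𝓡∂ N) x x)) :
    differential f x v ≤ 0 := by
  rw [differential_eq hf]
  refine IsLocalMaxOn.fderivWithin_nonpos ?_ hv
  refine Filter.Eventually.of_forall fun z => ?_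
  simp only [Function.comp, extChartAt_to_inv]
  exact hmax _

theorem ne_univ_of_isAdmissible [CompactSpace M] [Nonempty M] {g : SmoothMetric N M}
    {ε ε₀ : ℝ} {V : Set M} {d : M → ℝ} {R : Set M} (hR : IsAdmissible g ε ε₀ V d R) :
    V ≠ univ := by
  rintro rfl
  obtain ⟨x, -, hx⟩ := isCompact_univ.exists_isMaxOn univ_nonempty
    hR.smooth.continuous.continuousOn
  have hmax : ∀ z, d z ≤ d x := fun z => hx (mem_univ z)
  have hd : MDifferentiableAt (𝓡∂ N) 𝓘(ℝ, ℝ) d x := (hR.smooth x).mdifferentiableAt (by simp)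
  by_cases hb : x ∈ (𝓡∂ N).boundary M
  · have hneg := hR.normal_neg x ⟨hb, by simp⟩
    rw [grad, metricAt_sharp, outwardNormal, map_neg, map_smul, smul_eq_mul] at hneg
    set w := sharp g x normalCoord
    have hw : 0 < normalCoord w := by
      rw [← metricAt_sharp g x normalCoord]
      refine metricAt_pos g x _ fun h0 => ?_
      have h1 := metricAt_sharp g x normalCoord (EuclideanSpace.single 0 1)
      rw [h0] at h1
      simp [normalCoord] at h1
    have hcone : w ∈ posTangentConeAt (range (𝓡∂ N)) (extChartAt (𝓡∂ N) x x) := by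
      refine mem_posTangentConeAt_of_segment_subset fun z hz => ?_
      obtain ⟨t, ht, rfl⟩ := (segment_eq_image' ℝ _ _).subset hz
      have h1 := mem_range_iff.1 (extChartAt_mem_range (N := N) x x)
      rw [mem_range_iff, map_add, map_smul, add_sub_cancel_left, smul_eq_mul]
      have := ht.1
      positivity
    have h2 := differential_nonpos_of_isMax hd hmax hcone
    have h3 : 0 ≤ (tnorm g x w)⁻¹ := inv_nonneg.2 (Real.sqrt_nonneg _)
    linarith [mul_nonpos_of_nonneg_of_nonpos h3 h2]
  · have hint : range (𝓡∂ N) ∈ 𝓝 (extChartAt (𝓡∂ N) x x) := by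
      rw [← mem_interior_iff_mem_nhds]
      have h1 : x ∈ (𝓡∂ N).interior M := by
        rw [← ModelWithCorners.compl_boundary]
        exact hb
      exact h1
    have hcone : ∀ v, v ∈ posTangentConeAt (range (𝓡∂ N)) (extChartAt (𝓡∂ N) x x) := by
      intro v
      rw [posTangentConeAt, tangentConeAt_of_mem_nhds hint]
      trivial
    have hzero : differential (N := N) d x = 0 := by
      ext v
      have h1 := differential_nonpos_of_isMax hd hmax (hcone v)
      have h2 := differential_nonpos_of_isMax hd hmax (hcone (-v))
      rw [map_neg] at h2
      simp only [zero_apply]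
      linarith
    obtain ⟨c, hc, hgrad⟩ := hR.grad_pos
    have h1 := hgrad x (mem_univ x)
    have h2 : tnorm g x (grad g d x) = 0 := by
      rw [tnorm, grad, metricAt_sharp, hzero]
      simp
    simp only [h2] at h1
    linarith

/-! ### Decompositions -/

theorem exists_decomposition [T2Space M] [CompactSpace M] [ConnectedSpace M]
    (g : SmoothMetric N M) {ε ε₀ : ℝ} {V : Set M} {d : M → ℝ} {R : Set M}
    (hR : IsAdmissible g ε ε₀ V d R) {m : ℕ} {Vj : Fin m → Set M} (hV : IsPieces V Vj) :
    ∃ (n : ℕ) (Ω : Fin (m + n) → Set M) (dj : Fin (m + n) → M → ℝ),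
      IsOverlappingDecomposition g R (Fin.append Vj fun _ : Fin n => ∅) Ω dj := by
  have := locallyConnectedSpace_halfSpace N
  have : LocallyConnectedSpace M := ChartedSpace.locallyConnectedSpace (EuclideanHalfSpace N) M
  have hVu := ne_univ_of_isAdmissible hR
  have hVR : Vᶜ ⊆ R := subset_closure.trans hR.compl_subset
  have hsub : ∀ j, Vj j ⊆ V := fun j => hV.iUnion ▸ subset_iUnion Vj j
  have hloc : ∀ p : M, ∃ (U : Set M) (f : M → ℝ), IsOpen U ∧ p ∈ U ∧ IsConnected U ∧
      ContMDiff (𝓡∂ N) 𝓘(ℝ, ℝ) ∞ f ∧ HessGeOn g f U ∧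
      PosInfOn (fun x => tnorm g x (grad g f x)) U ∧ PosInfOn f U := by
    intro p
    obtain ⟨f, hf, U, hU, hH, ⟨c, hc, hG⟩, ⟨c', hc', hP⟩⟩ := exists_local_escape g p
    obtain ⟨B, ⟨hBo, hpB, hBc⟩, hBU⟩ :=
      (LocallyConnectedSpace.open_connected_basis p).mem_iff.1 hU
    exact ⟨B, f, hBo, hpB, hBc, hf, fun x hx => hH x (hBU hx),
      ⟨c, hc, fun x hx => hG x (hBU hx)⟩, ⟨c', hc', fun x hx => hP x (hBU hx)⟩⟩
  choose U f hUo hpU hUc hfs hH hG hP using hloc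
  obtain ⟨t, htV, htcov⟩ := hR.isOpen_V.isClosed_compl.isCompact.elim_nhds_subcover U
    fun x _ => (hUo x).mem_nhds (hpU x)
  obtain ⟨p₀, hp₀⟩ := (ne_univ_iff_exists_notMem V).1 hVu
  set q : Fin (t.card + 2) → M := fun i =>
    if h : i.1 < t.card then (t.equivFin.symm ⟨i, h⟩ : M) else p₀ with hqdef
  have hqR : ∀ i, q i ∈ R := by
    intro i
    simp only [hqdef]
    split_ifs with h
    · exact hVR (htV _ (t.equivFin.symm ⟨i, h⟩).2)
    · exact hVR hp₀
  have hqsurj : ∀ x ∈ t, ∃ i, q i = x := by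
    intro x hx
    refine ⟨⟨t.equivFin ⟨x, hx⟩, by omega⟩, ?_⟩
    simp [hqdef]
  set Ω : Fin (m + (t.card + 2)) → Set M := Fin.append Vj fun i => U (q i) with hΩ
  have hΩo : ∀ j, IsOpen (Ω j) := Fin.addCases
    (fun i => by simpa [hΩ] using hV.isOpen i) fun i => by simpa [hΩ] using hUo _
  have hΩc : ∀ j, IsConnected (Ω j) := Fin.addCases
    (fun i => by simpa [hΩ] using hV.isConnected i) fun i => by simpa [hΩ] using hUc _
  have hcov : ⋃ j, Ω j = univ := by
    refine eq_univ_of_forall fun x => mem_iUnion.2 ?_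
    by_cases hx : x ∈ V
    · rw [← hV.iUnion] at hx
      obtain ⟨j, hj⟩ := mem_iUnion.1 hx
      exact ⟨Fin.castAdd _ j, by simpa [hΩ] using hj⟩
    · obtain ⟨y, hy, hxy⟩ := mem_iUnion₂.1 (htcov hx)
      obtain ⟨i, rfl⟩ := hqsurj y hy
      exact ⟨Fin.natAdd m i, by simpa [hΩ] using hxy⟩
  obtain ⟨c, hc, hgrad⟩ := hR.grad_pos
  obtain ⟨c', hc', hpos⟩ := hR.pos
  refine ⟨t.card + 2, Ω, Fin.append (fun _ => d) fun i => f (q i),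
    ⟨hΩo, hΩc, hcov, exists_inter_nonempty_of_cover (by omega) hΩo
      (fun j => (hΩc j).nonempty) hcov⟩, ?_, ?_, ?_, ?_, ?_, ?_, ?_⟩
  all_goals refine Fin.addCases (fun i => ?_) fun i => ?_
  all_goals simp only [hΩ, Fin.append_left, Fin.append_right]
  · exact subset_rfl
  · exact empty_subset _
  · refine inter_nonempty_of_isPieces hV hR.isOpen_region hVR fun h => hVu ?_
    exact univ_subset_iff.1 (h ▸ hsub i)
  · exact ⟨q i, hpU _, hqR i⟩
  · exact hR.smooth
  · exact hfs _
  · exact fun x hx => hR.hess_ge x (subset_closure (hsub i hx))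
  · exact hH _
  · exact ⟨c, hc, fun x hx => hgrad x (hsub i hx)⟩
  · exact hG _
  · exact ⟨c', hc', fun x hx => hpos x (subset_closure (hsub i hx))⟩
  · exact hP _
  · exact fun x hx => hR.normal_neg x ⟨hx.1, closure_mono (hsub i) hx.2⟩
  · intro x hx
    simp at hx

theorem exists_decomposition_of_localEscapeCover [T2Space M] [CompactSpace M] [ConnectedSpace M]
    (g : SmoothMetric N M) {ε ε₀ : ℝ} {V : Set M} {d : M → ℝ} {R : Set M}
    (hR : IsAdmissible g ε ε₀ V d R) {m : ℕ} {Vj : Fin m → Set M} (hV : IsPieces V Vj)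
    (hm : 2 ≤ m) {W : Fin m → Set M} {f : Fin m → M → ℝ} (hW : IsLocalEscapeCover g Vj W f) :
    ∃ (Ω : Fin m → Set M) (dj : Fin m → M → ℝ), IsOverlappingDecomposition g R Vj Ω dj := by
  have := locallyConnectedSpace_halfSpace N
  have : LocallyConnectedSpace M := ChartedSpace.locallyConnectedSpace (EuclideanHalfSpace N) M
  have hVu := ne_univ_of_isAdmissible hR
  have hVR : Vᶜ ⊆ R := subset_closure.trans hR.compl_subset
  have hsub : ∀ j, Vj j ⊆ V := fun j => hV.iUnion ▸ subset_iUnion Vj j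
  obtain ⟨C, hCcov, hCc, hCW⟩ := exists_iUnion_eq_closed_subset hW.isOpen
    (fun x => toFinite _) hW.cover
  have hΩ : ∀ j, ∃ Ω, IsOpen Ω ∧ IsConnected Ω ∧ C j ∪ closure (Vj j) ⊆ Ω ∧ closure Ω ⊆ W j :=
    fun j => exists_isConnected_between ((hCc j).union isClosed_closure).isCompact (hW.isOpen j)
      (hW.isConnected j) (union_subset (hCW j) (hW.closure_subset j))
  choose Ω hΩo hΩc hCΩ hΩW using hΩ
  have hΩW' : ∀ j, Ω j ⊆ W j := fun j => subset_closure.trans (hΩW j)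
  have hext : ∀ j, ∃ F : M → ℝ, ContMDiff (𝓡∂ N) 𝓘(ℝ, ℝ) ∞ F ∧
      ∀ x ∈ Ω j, F =ᶠ[𝓝 x] f j := by
    intro j
    obtain ⟨T, hTo, hΩT, hTW⟩ := normal_exists_closure_subset isClosed_closure (hW.isOpen j) (hΩW j)
    obtain ⟨χ, hχ1, hχ0, -⟩ := exists_contMDiffMap_one_nhds_of_subset_interior (𝓡∂ N) (n := ⊤)
      (isClosed_closure (s := Ω j)) (hΩT.trans hTo.interior_eq.symm.subset)
    refine ⟨fun x => χ x * f j x, ?_, fun x hx => ?_⟩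
    · refine contMDiff_of_tsupport fun x hx => ?_
      have hxW : x ∈ W j := by
        refine hTW (closure_mono ?_ hx)
        intro z hz
        by_contra hzT
        exact hz (by simp [hχ0 z hzT])
      exact χ.contMDiff.contMDiffAt.mul
        ((hW.smooth j x hxW).contMDiffAt ((hW.isOpen j).mem_nhds hxW))
    · have h1 := Filter.Eventually.filter_mono (nhds_le_nhdsSet (subset_closure hx)) hχ1
      filter_upwards [h1] with z hz
      simp [hz]
  choose F hFs hF using hext
  have hcov : ⋃ j, Ω j = univ := by
    refine univ_subset_iff.1 (hCcov ▸ ?_)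
    exact iUnion_mono fun j => subset_union_left.trans (hCΩ j)
  have hVΩ : ∀ j, closure (Vj j) ⊆ Ω j := fun j => subset_union_right.trans (hCΩ j)
  refine ⟨Ω, F, ⟨hΩo, hΩc, hcov, exists_inter_nonempty_of_cover hm hΩo
      (fun j => (hΩc j).nonempty) hcov⟩, fun j => subset_closure.trans (hVΩ j), fun j => ?_, hFs,
    fun j x hx X => ?_, fun j => ?_, fun j => ?_, fun j x hx => ?_⟩
  · refine (inter_nonempty_of_isPieces hV hR.isOpen_region hVR fun h => hVu ?_).mono
      (inter_subset_inter_left _ (subset_closure.trans (hVΩ j)))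
    exact univ_subset_iff.1 (h ▸ hsub j)
  · rw [hess_congr g (hF j x hx)]
    exact hW.hess_ge j x (hΩW' j hx) X
  · obtain ⟨c, hc, h⟩ := hW.grad_pos j
    refine ⟨c, hc, fun x hx => ?_⟩
    simp only [grad_congr g (hF j x hx)]
    exact h x (hΩW' j hx)
  · obtain ⟨c, hc, h⟩ := hW.pos j
    refine ⟨c, hc, fun x hx => ?_⟩
    rw [(hF j x hx).eq_of_nhds]
    exact h x (hΩW' j hx)
  · rw [grad_congr g (hF j x (hVΩ j hx.2))]
    exact hW.normal_neg j x hx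

end

end Escape

end

theorem mainTheorem7 {N : ℕ} [NeZero N] {M : Type*} [TopologicalSpace M] [T2Space M]
    [CompactSpace M] [ConnectedSpace M] [ChartedSpace (EuclideanHalfSpace N) M]
    [IsManifold (𝓡∂ N) ∞ M] (g : Escape.SmoothMetric N M)
    (ε ε₀ : ℝ) (V : Set M) (d : M → ℝ) (R : Set M) (hR : Escape.IsAdmissible g ε ε₀ V d R)
    (m : ℕ) (Vj : Fin m → Set M) (hV : Escape.IsPieces V Vj) :
    (∃ (n : ℕ) (Ω : Fin (m + n) → Set M) (dj : Fin (m + n) → M → ℝ),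
      Escape.IsOverlappingDecomposition g R (Fin.append Vj fun _ : Fin n => ∅) Ω dj) ∧
    (2 ≤ m → ∀ (W : Fin m → Set M) (f : Fin m → M → ℝ), Escape.IsLocalEscapeCover g Vj W f →
      ∃ (Ω : Fin m → Set M) (dj : Fin m → M → ℝ),
        Escape.IsOverlappingDecomposition g R Vj Ω dj) :=
  ⟨Escape.exists_decomposition g hR hV, fun hm _ _ hW =>
    Escape.exists_decomposition_of_localEscapeCover g hR hV hm hW⟩
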